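/- All graphs are finite and simple. A set $D$ of vertices of a graph $G$ is dominating if every vertex of $G$ belongs to $D$ or is adjacent to a vertex of $D$; it is a minimal dominating set if no proper subset of $D$ is dominating. Let $\gamma(G)$ be the minimum cardinality of a dominating set of $G$ and let $\Gamma(G)$ be the maximum cardinality of a minimal dominating set of $G$. The graph $G$ is well-dominated if $\gamma(G)=\Gamma(G)$, that is, if every minimal dominating set has minimum cardinality among all dominating sets. Let $K_m$ denote the complete graph and $P_m$ the path on $m$ vertices, and let $G\mathbin{\square}H$ denote the Cartesian product, with vertex set $V(G)\times V(H)$, in which $(g_1,h_1)$ and $(g_2,h_2)$ are adjacent if and only if either $g_1=g_2$ and $h_1h_2\in E(H)$, or $h_1=h_2$ and $g_1g_2\in E(G)$. **Theorem.** Let $m\ge 2$ be an integer and let $H$ be a connected graph with at least two vertices. Then $K_m\mathbin{\square}H$ is well-dominated if and only if either $m\ne 3$ and $H\cong K_m$, or $m=3$ and $H$ is isomorphic to $K_3$ or to $P_3$. -/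

import Mathlib

/-- `D` is a dominating set of `G`: every vertex lies in the closed neighborhood `N[D]`. -/
def IsDominatingSet {V : Type*} (G : SimpleGraph V) (D : Finset V) : Prop :=
  ∀ v : V, v ∈ D ∨ ∃ u ∈ D, G.Adj u v

/-- `D` is a dominating set no proper subset of which is dominating. -/
def IsMinimalDominatingSet {V : Type*} (G : SimpleGraph V) (D : Finset V) : Prop :=
  IsDominatingSet G D ∧ ∀ D' : Finset V, D' ⊂ D → ¬ IsDominatingSet G D'

/-- The domination number `γ(G)`: the minimum cardinality of a dominating set. -/
noncomputable def dominationNumber {V : Type*} (G : SimpleGraph V) : ℕ :=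
  sInf {k : ℕ | ∃ D : Finset V, IsDominatingSet G D ∧ D.card = k}

/-- The upper domination number `Γ(G)`: the largest cardinality of a minimal dominating set
(of a graph on a finite vertex set). -/
noncomputable def upperDominationNumber {V : Type*} (G : SimpleGraph V) : ℕ :=
  sSup {k : ℕ | ∃ D : Finset V, IsMinimalDominatingSet G D ∧ D.card = k}

/-- A finite graph is well-dominated if `γ(G) = Γ(G)`. -/
def IsWellDominated {V : Type*} (G : SimpleGraph V) : Prop :=
  dominationNumber G = upperDominationNumber G

/-- Every dominating set of a graph contains a minimal one. -/
theorem IsDominatingSet.exists_minimal {V : Type*} {G : SimpleGraph V} (D : Finset V)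
    (hD : IsDominatingSet G D) : ∃ M ⊆ D, IsMinimalDominatingSet G M := by
  induction D using Finset.strongInduction with
  | H D ih =>
    by_cases h : ∃ D' : Finset V, D' ⊂ D ∧ IsDominatingSet G D'
    · obtain ⟨D', h1, h2⟩ := h
      obtain ⟨M, hM, hmin⟩ := ih D' h1 h2
      exact ⟨M, hM.trans h1.subset, hmin⟩
    · push Not at h
      exact ⟨D, subset_rfl, hD, h⟩

/-- A finite graph is well-dominated if and only if each minimal dominating set has the least
cardinality among all dominating sets. -/
theorem isWellDominated_iff {V : Type*} [Finite V] (G : SimpleGraph V) :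
    IsWellDominated G ↔ ∀ D : Finset V, IsMinimalDominatingSet G D →
      ∀ D' : Finset V, IsDominatingSet G D' → D.card ≤ D'.card := by
  have := Fintype.ofFinite V
  have hbdd : BddAbove {k : ℕ | ∃ D : Finset V, IsMinimalDominatingSet G D ∧ D.card = k} :=
    ⟨Fintype.card V, by rintro k ⟨D, -, rfl⟩; exact D.card_le_univ⟩
  have huniv : IsDominatingSet G Finset.univ := fun v => Or.inl (Finset.mem_univ v)
  obtain ⟨M, -, hM⟩ := huniv.exists_minimal
  constructor
  · intro h D hD D' hD'
    calc D.card ≤ upperDominationNumber G := le_csSup hbdd ⟨D, hD, rfl⟩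
      _ = dominationNumber G := h.symm
      _ ≤ D'.card := Nat.sInf_le ⟨D', hD', rfl⟩
  · intro h
    apply le_antisymm
    · have h1 : dominationNumber G ≤ M.card := Nat.sInf_le ⟨M, hM.1, rfl⟩
      have h2 : M.card ≤ upperDominationNumber G := le_csSup hbdd ⟨M, hM, rfl⟩
      exact h1.trans h2
    · refine csSup_le ⟨M.card, M, hM, rfl⟩ ?_
      rintro k ⟨D, hD, rfl⟩
      refine le_csInf ⟨_, Finset.univ, huniv, rfl⟩ ?_
      rintro k ⟨D', hD', rfl⟩
      exact h D hD D' hD'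

section

open Finset SimpleGraph

/-! ### Private neighbors and transport along isomorphisms -/

section WellDominated

variable {V V' : Type*} {G : SimpleGraph V} {G' : SimpleGraph V'}

/-! Call `{i} × W` a layer and `K × {w}`, a clique, a fibre; let `m = |K|`. A layer is a minimal
dominating set, so in a well-dominated product all minimal dominating sets have `|W|` elements.
Dominating sets that are too small, or have too many members with private neighbors, then constrain
`H`: degrees are below `m`, and closed neighborhoods of adjacent vertices are nested
(`closedNeighborhood_subset_or_subset`). By connectedness a vertex of maximum degree is universal;
its fibre is a minimal dominating set, whence `m = |W|`. If `|W| > 3`, a missing edge yields more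
than `|W|` vertices with private neighbors.

Conversely, in the listed products every dominating set contains one of order `m`. -/

theorem IsMinimalDominatingSet.eq_of_subset {D E : Finset V} (hD : IsMinimalDominatingSet G D)
    (hE : IsDominatingSet G E) (h : E ⊆ D) : E = D := by
  by_contra hne
  exact hD.2 E (h.ssubset_of_ne hne) hE

/-- In a well-dominated graph, a subset `T` of a dominating set `S` each of whose members has a
private neighbor with respect to `S` is no larger than any dominating set. -/
theorem IsWellDominated.card_le_of_private [Finite V] (hG : IsWellDominated G)
    {S T D : Finset V} (hS : IsDominatingSet G S)
    (hT : ∀ t ∈ T, ∃ p, ∀ s ∈ S, s = p ∨ G.Adj s p → s = t) (hD : IsDominatingSet G D) :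
    T.card ≤ D.card := by
  obtain ⟨M, hMS, hM⟩ := hS.exists_minimal
  have hTM : T ⊆ M := by
    intro t ht
    obtain ⟨p, hp⟩ := hT t ht
    rcases hM.1 p with h | ⟨u, hu, hup⟩
    · exact hp p (hMS h) (Or.inl rfl) ▸ h
    · exact hp u (hMS hu) (Or.inr hup) ▸ hu
  exact (card_le_card hTM).trans ((isWellDominated_iff G).1 hG M hM D hD)

theorem IsDominatingSet.map {D : Finset V} (hD : IsDominatingSet G D) (e : G ≃g G') :
    IsDominatingSet G' (D.map e.toEquiv.toEmbedding) := by
  intro v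
  rcases hD (e.symm v) with h | ⟨u, hu, huv⟩
  · left
    exact mem_map.2 ⟨_, h, e.apply_symm_apply v⟩
  · refine Or.inr ⟨e u, mem_map_of_mem _ hu, ?_⟩
    simpa using (e.map_adj_iff (v := u) (w := e.symm v)).2 huv

theorem IsMinimalDominatingSet.map {D : Finset V} (hD : IsMinimalDominatingSet G D)
    (e : G ≃g G') : IsMinimalDominatingSet G' (D.map e.toEquiv.toEmbedding) := by
  refine ⟨hD.1.map e, fun E hE hdom => hD.2 _ ?_ (hdom.map e.symm)⟩
  have h := Finset.map_ssubset_map (f := e.symm.toEquiv.toEmbedding) |>.2 hE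
  convert h using 1
  rw [Finset.map_map]
  convert (map_refl (s := D)).symm using 2
  ext x
  exact e.symm_apply_apply x

theorem IsWellDominated.of_iso [Finite V] [Finite V'] (hG : IsWellDominated G) (e : G ≃g G') :
    IsWellDominated G' := by
  rw [isWellDominated_iff] at hG ⊢
  intro D hD D' hD'
  simpa using hG _ (hD.map e.symm) _ (hD'.map e.symm)

end WellDominated

/-- Isomorphic second factors give isomorphic Cartesian products. -/
def SimpleGraph.Iso.boxProdRight {K W W' : Type*} (G : SimpleGraph K) {H : SimpleGraph W}
    {H' : SimpleGraph W'} (e : H ≃g H') : (G □ H) ≃g (G □ H') where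
  toEquiv := (Equiv.refl K).prodCongr e.toEquiv
  map_rel_iff' := by
    rintro ⟨a, b⟩ ⟨c, d⟩
    have h : H'.Adj (e b) (e d) ↔ H.Adj b d := e.map_adj_iff
    simp [boxProd_adj, h]

/-! ### The well-dominated products -/

theorem isWellDominated_of_forall_exists_subset {V : Type*} [Finite V] {G : SimpleGraph V} (k : ℕ)
    (h : ∀ D, IsDominatingSet G D → ∃ E ⊆ D, E.card = k ∧ IsDominatingSet G E) :
    IsWellDominated G := by
  rw [isWellDominated_iff]
  intro D hD D' hD'
  obtain ⟨E, hE, hk, hdom⟩ := h D hD.1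
  obtain ⟨E', hE', hk', -⟩ := h D' hD'
  rw [← hD.eq_of_subset hdom hE, hk, ← hk']
  exact card_le_card hE'

theorem isDominatingSet_top_boxProd_iff {K W : Type*} {H : SimpleGraph W} {D : Finset (K × W)} :
    IsDominatingSet ((⊤ : SimpleGraph K) □ H) D ↔
      ∀ i w, (∃ j, (j, w) ∈ D) ∨ ∃ x, H.Adj x w ∧ (i, x) ∈ D := by
  simp only [IsDominatingSet, Prod.forall, Prod.exists, boxProd_adj, top_adj]
  refine forall₂_congr fun i w => ?_
  grind

/-- A set containing the graph of a function from the second factor to a complete first factor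
contains a dominating set of the order of the second factor. -/
theorem exists_dominating_subset_of_forall_snd {K W : Type*} [Fintype W] {H : SimpleGraph W}
    {D : Finset (K × W)} (h : ∀ j, ∃ i, (i, j) ∈ D) :
    ∃ E ⊆ D, E.card = Fintype.card W ∧ IsDominatingSet ((⊤ : SimpleGraph K) □ H) E := by
  classical
  choose f hf using h
  refine ⟨univ.image fun j => (f j, j), by grind, ?_, fun ⟨i, j⟩ => ?_⟩
  · exact (card_image_of_injective _ fun a b h => (Prod.ext_iff.1 h).2).trans card_univ
  · by_cases hj : f j = i
    · left; simp [hj]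
    · exact Or.inr ⟨(f j, j), by simp, by simp [boxProd_adj, hj]⟩

/-- Two complete factors of equal order have a well-dominated Cartesian product. -/
theorem isWellDominated_top_boxProd_top (K : Type*) [Fintype K] :
    IsWellDominated ((⊤ : SimpleGraph K) □ (⊤ : SimpleGraph K)) := by
  classical
  refine isWellDominated_of_forall_exists_subset (Fintype.card K) fun D hD => ?_
  by_cases h : ∀ j, ∃ i, (i, j) ∈ D
  · exact exists_dominating_subset_of_forall_snd h
  -- If layer `i` and fibre `j` were both missed, `(i, j)` would be undominated.
  have h : ∀ i, ∃ j, (i, j) ∈ D := by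
    by_contra! h'
    push Not at h
    obtain ⟨⟨i, hi⟩, j, hj⟩ := And.intro h' h
    have := isDominatingSet_top_boxProd_iff.1 hD i j
    grind
  choose f hf using h
  refine ⟨univ.image fun i => (i, f i), by grind, ?_, fun ⟨i, j⟩ => ?_⟩
  · exact (card_image_of_injective _ fun a b h => (Prod.ext_iff.1 h).1).trans card_univ
  · by_cases hj : f i = j
    · left; simp [hj]
    · exact Or.inr ⟨(i, f i), by simp, by simp [boxProd_adj, hj]⟩

theorem isWellDominated_top_boxProd_pathGraph_three :
    IsWellDominated ((⊤ : SimpleGraph (Fin 3)) □ pathGraph 3) := by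
  refine isWellDominated_of_forall_exists_subset 3 fun D hD => ?_
  have adj : ∀ j j' : Fin 3, (pathGraph 3).Adj j j' ↔ j ≠ j' ∧ (j = 1 ∨ j' = 1) := by
    intro j j'
    rw [pathGraph_adj]
    grind
  have dom : ∀ i j, (∃ i', (i', j) ∈ D) ∨ ∃ j', j' ≠ j ∧ (j = 1 ∨ j' = 1) ∧ (i, j') ∈ D := by
    intro i j
    have := isDominatingSet_top_boxProd_iff.1 hD i j
    grind
  by_cases hrow : ∀ j, ∃ i, (i, j) ∈ D
  · simpa using exists_dominating_subset_of_forall_snd hrow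
  -- One vertex per layer suffices if all lie in the middle fibre or both end fibres are met.
  have image : ∀ f : Fin 3 → Fin 3, (∀ i, (i, f i) ∈ D) →
      ((∀ i, f i = 1) ∨ (∃ i, f i = 0) ∧ ∃ i, f i = 2) →
      ∃ E ⊆ D, E.card = 3 ∧ IsDominatingSet ((⊤ : SimpleGraph (Fin 3)) □ pathGraph 3) E := by
    intro f hf hf'
    refine ⟨univ.image fun i => (i, f i), by grind, ?_, fun ⟨i, j⟩ => ?_⟩
    · exact card_image_of_injective _ fun a b h => (Prod.ext_iff.1 h).1
    · by_cases hj : j = f i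
      · left; simp [hj]
      · have : (∃ i', f i' = j) ∨ j = 1 ∨ f i = 1 := by grind
        rcases this with ⟨i', hi'⟩ | h
        · exact Or.inr ⟨(i', f i'), by simp, by simp only [boxProd_adj, top_adj]; grind⟩
        · exact Or.inr ⟨(i, f i), by simp, by simp only [boxProd_adj, adj]; grind⟩
  by_cases hmid : ∀ i, (i, 1) ∈ D
  · exact image (fun _ => 1) hmid (Or.inl fun _ => rfl)
  -- An empty end fibre can only be dominated by the whole middle fibre.
  have h0 : ∃ i, (i, 0) ∈ D := by
    by_contra h
    refine hmid fun i => ?_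
    have := dom i 0
    grind
  have h2 : ∃ i, (i, 2) ∈ D := by
    by_contra h
    refine hmid fun i => ?_
    have := dom i 2
    grind
  have hne : ¬ ∃ i, (i, 1) ∈ D := fun h => hrow fun j => by
    fin_cases j
    exacts [h0, h, h2]
  have h1 : ∀ i, (i, 0) ∈ D ∨ (i, 2) ∈ D := by
    intro i
    have := dom i 1
    grind
  -- If `i = j`, any other layer, here `i + 1`, also meets an end fibre and can replace one of the
  -- two.
  obtain ⟨i, j, hij, hi, hj⟩ : ∃ i j, i ≠ j ∧ (i, 0) ∈ D ∧ (j, 2) ∈ D := by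
    obtain ⟨i, hi⟩ := h0
    obtain ⟨j, hj⟩ := h2
    by_cases hij : i = j
    · rcases h1 (i + 1) with h | h
      · exact ⟨i + 1, j, by grind, h, hj⟩
      · exact ⟨i, i + 1, by grind, hi, h⟩
    · exact ⟨i, j, hij, hi, hj⟩
  exact image (fun k => if k = i then 0 else if k = j then 2 else if (k, 0) ∈ D then 0 else 2)
    (by grind) (Or.inr ⟨⟨i, by grind⟩, j, by grind⟩)

/-- A copy of the second factor dominates the Cartesian product with a complete graph. -/
theorem isDominatingSet_singleton_product {K W : Type*} [Fintype W] (H : SimpleGraph W) (o : K) :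
    IsDominatingSet ((⊤ : SimpleGraph K) □ H) ({o} ×ˢ univ) := by
  exact isDominatingSet_top_boxProd_iff.2 fun i w => Or.inl ⟨o, by simp⟩

theorem card_insert_neighborFinset {W : Type*} [DecidableEq W] (H : SimpleGraph W) (v : W)
    [Fintype (H.neighborSet v)] : (insert v (H.neighborFinset v)).card = H.degree v + 1 := by
  rw [card_insert_of_notMem (by simp), card_neighborFinset_eq_degree]

theorem card_compl_product_union {K W : Type*} [Fintype K] [DecidableEq K] [DecidableEq W] (o : K)
    (s t : Finset W) :
    ({o}ᶜ ×ˢ s ∪ {o} ×ˢ t).card = (Fintype.card K - 1) * s.card + t.card := by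
  rw [card_union_of_disjoint]
  · simp [card_product, card_compl]
  · exact disjoint_product.2 (Or.inl disjoint_compl_left)

/-! ### Constraints on the second factor -/

namespace IsWellDominated

theorem card_le_card_of_private {K W : Type*} [Finite K] [Fintype W] {H : SimpleGraph W}
    (hG : IsWellDominated ((⊤ : SimpleGraph K) □ H)) {S T : Finset (K × W)}
    (hS : IsDominatingSet ((⊤ : SimpleGraph K) □ H) S)
    (hT : ∀ t ∈ T, ∃ i w, ∀ j x, (j, x) ∈ S →
      x = w ∨ H.Adj x w ∧ j = i → (j, x) = t) :
    T.card ≤ Fintype.card W := by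
  rcases T.eq_empty_or_nonempty with rfl | ⟨⟨o, -⟩, -⟩
  · simp
  have := hG.card_le_of_private hS (T := T) ?_ (isDominatingSet_singleton_product H o)
  · simpa using this
  intro t ht
  obtain ⟨i, w, h⟩ := hT t ht
  refine ⟨(i, w), ?_⟩
  rintro ⟨j, x⟩ hs hadj
  apply h j x hs
  simp only [boxProd_adj, top_adj, Prod.mk.injEq] at hadj
  tauto

/-- Each vertex of a layer has its copy in another layer as a private neighbor. -/
theorem card_le_of_isDominatingSet {K W : Type*} [Finite K] [Nontrivial K] [Fintype W]
    {H : SimpleGraph W} (hG : IsWellDominated ((⊤ : SimpleGraph K) □ H)) {D : Finset (K × W)}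
    (hD : IsDominatingSet ((⊤ : SimpleGraph K) □ H) D) : Fintype.card W ≤ D.card := by
  obtain ⟨o, o', ho⟩ := exists_pair_ne K
  have := hG.card_le_of_private (isDominatingSet_singleton_product H o)
    (T := {o} ×ˢ univ) ?_ hD
  · simpa using this
  · rintro ⟨i, w⟩ hi
    refine ⟨(o', w), ?_⟩
    rintro ⟨j, x⟩ hj
    simp only [mem_product, mem_singleton, mem_univ, and_true] at hi hj
    simp only [boxProd_adj, top_adj, Prod.mk.injEq]
    grind

section

variable {K W : Type*} [Fintype K] [Nontrivial K] [Fintype W] [DecidableEq K] [DecidableEq W]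
  {H : SimpleGraph W} [DecidableRel H.Adj]

/-- Otherwise place distinct neighbors of `v` in the `m` layers, one in each. A maximum independent
set containing them dominates, meets each fibre at most once and misses that of `v`: it is too
small. -/
theorem degree_lt_card (hG : IsWellDominated ((⊤ : SimpleGraph K) □ H)) (v : W) :
    H.degree v < Fintype.card K := by
  classical
  by_contra! hdeg
  rw [← card_neighborFinset_eq_degree, ← Fintype.card_coe] at hdeg
  obtain ⟨f⟩ := Function.Embedding.nonempty_of_card_le hdeg
  let P : Finset (K × W) → Prop := fun I =>
    (∀ i, (i, (f i : W)) ∈ I) ∧ ∀ p ∈ I, ∀ q ∈ I, ¬ ((⊤ : SimpleGraph K) □ H).Adj p q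
  have hne : (univ.filter P).Nonempty := by
    refine ⟨univ.image fun i => (i, (f i : W)), ?_⟩
    simp only [P, mem_filter, mem_univ, true_and, mem_image]
    refine ⟨fun i => ⟨i, rfl⟩, ?_⟩
    rintro _ ⟨i, rfl⟩ _ ⟨j, rfl⟩ hadj
    simp only [boxProd_adj, top_adj] at hadj
    rcases hadj with ⟨h1, h2⟩ | ⟨h1, rfl⟩
    · exact h1 (f.injective (Subtype.ext h2))
    · exact H.irrefl h1
  obtain ⟨I, hI, hmax⟩ := exists_max_image _ card hne
  simp only [P, mem_filter, mem_univ, true_and] at hI hmax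
  have hdom : IsDominatingSet ((⊤ : SimpleGraph K) □ H) I := by
    intro p
    by_contra! hp
    have := hmax (insert p I) ⟨fun i => mem_insert_of_mem (hI.1 i), ?_⟩
    · rw [card_insert_of_notMem hp.1] at this
      omega
    · intro q hq' r hr' hadj
      rcases mem_insert.1 hq' with rfl | hq <;> rcases mem_insert.1 hr' with rfl | hr
      · exact SimpleGraph.irrefl _ hadj
      · exact hp.2 r hr hadj.symm
      · exact hp.2 q hq hadj
      · exact hI.2 q hq r hr hadj
  have hle := hG.card_le_of_isDominatingSet hdom
  have hlt : I.card < Fintype.card W := by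
    rw [← card_image_of_injOn (f := Prod.snd) (s := I)]
    · refine card_lt_univ_of_notMem (x := v) fun hv => ?_
      obtain ⟨⟨i, w⟩, hi, rfl⟩ := mem_image.1 hv
      refine hI.2 _ hi _ (hI.1 i) ?_
      exact boxProd_adj.2 (Or.inr ⟨(H.mem_neighborFinset _ _).1 (f i).2, rfl⟩)
    · rintro ⟨i, w⟩ hi ⟨j, x⟩ hj (rfl : w = x)
      by_contra hne
      exact hI.2 _ hi _ hj (boxProd_adj.2 (Or.inl ⟨fun h => hne (Prod.ext h rfl), rfl⟩))
  omega

/-- Otherwise the copies of `v` outside layer `o`, with the complement of `N[v]` in layer `o`, form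
a dominating set of order `(m - 1) + (|W| - m) < |W|`. -/
theorem exists_adj_forall_adj (hG : IsWellDominated ((⊤ : SimpleGraph K) □ H)) {v : W}
    (hv : H.degree v + 1 = Fintype.card K) :
    ∃ y, H.Adj v y ∧ ∀ z, H.Adj y z → z = v ∨ H.Adj v z := by
  by_contra! hout
  obtain ⟨o, o', ho⟩ := exists_pair_ne K
  have hdom : IsDominatingSet ((⊤ : SimpleGraph K) □ H)
      ({o}ᶜ ×ˢ {v} ∪ {o} ×ˢ (insert v (H.neighborFinset v))ᶜ) := by
    rw [isDominatingSet_top_boxProd_iff]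
    intro i w
    simp only [mem_union, mem_product, mem_compl, mem_singleton, mem_insert, mem_neighborFinset]
    by_cases hwv : w = v
    · exact Or.inl ⟨o', Or.inl ⟨ho.symm, hwv⟩⟩
    by_cases hadj : H.Adj v w
    · by_cases hi : i = o
      · obtain ⟨z, hz, hne, hnadj⟩ := hout w hadj
        exact Or.inr ⟨z, hz.symm, Or.inr ⟨hi, by tauto⟩⟩
      · exact Or.inr ⟨v, hadj, Or.inl ⟨hi, rfl⟩⟩
    · exact Or.inl ⟨o, Or.inr ⟨rfl, by tauto⟩⟩
  have h1 := hG.card_le_of_isDominatingSet hdom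
  have h3 : (insert v (H.neighborFinset v)).card ≤ Fintype.card W := card_le_univ _
  rw [card_compl_product_union, card_singleton, card_compl, card_insert_neighborFinset] at h1
  rw [card_insert_neighborFinset] at h3
  have := Fintype.one_lt_card (α := K)
  omega

/-- The closed neighborhoods of adjacent vertices are comparable. -/
theorem closedNeighborhood_subset_or_subset (hG : IsWellDominated ((⊤ : SimpleGraph K) □ H))
    {a b : W} (hab : H.Adj a b) :
    insert a (H.neighborFinset a) ⊆ insert b (H.neighborFinset b) ∨
      insert b (H.neighborFinset b) ⊆ insert a (H.neighborFinset a) := by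
  by_contra! h
  obtain ⟨⟨w, hwa, hwb⟩, ⟨x, hxb, hxa⟩⟩ := And.intro (not_subset.1 h.1) (not_subset.1 h.2)
  obtain ⟨o, o', ho⟩ := exists_pair_ne K
  set A := insert a (H.neighborFinset a) with hA
  set B := insert b (H.neighborFinset b) with hB
  have memA : ∀ y, y ∈ A ↔ y = a ∨ H.Adj a y := by simp [hA]
  have memB : ∀ y, y ∈ B ↔ y = b ∨ H.Adj b y := by simp [hB]
  have hne := hab.ne
  have hS : IsDominatingSet ((⊤ : SimpleGraph K) □ H) (univ ×ˢ {a, b} ∪ {o} ×ˢ (A ∪ B)ᶜ) := by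
    rw [isDominatingSet_top_boxProd_iff]
    intro i y
    simp only [mem_union, mem_product, mem_compl, mem_singleton, mem_insert, mem_univ, true_and,
      memA, memB]
    by_cases hya : H.Adj a y
    · exact Or.inr ⟨a, hya, by simp⟩
    by_cases hyb : H.Adj b y
    · exact Or.inr ⟨b, hyb, by simp⟩
    exact Or.inl ⟨o, by tauto⟩
  -- The elements `(o, a)` and `(o, b)` are left out: in layer `o`, vertices outside `A ∪ B` may
  -- also dominate `w` or `x`.
  have hT : ∀ t ∈ ({o}ᶜ ×ˢ {a, b} ∪ {o} ×ˢ (A ∪ B)ᶜ : Finset (K × W)), ∃ i z, ∀ j y,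
      (j, y) ∈ (univ ×ˢ {a, b} ∪ {o} ×ˢ (A ∪ B)ᶜ : Finset (K × W)) → y = z ∨ H.Adj y z ∧ j = i → (j, y) = t := by
    rintro ⟨k, z⟩ ht
    simp only [mem_union, mem_product, mem_compl, mem_singleton, mem_insert, mem_univ, true_and,
      memA, memB, Prod.mk.injEq] at ht hwa hwb hxa hxb ⊢
    rcases ht with ⟨hk, rfl | rfl⟩ | ⟨rfl, hz⟩
    · exact ⟨k, w, by grind [SimpleGraph.adj_comm]⟩
    · exact ⟨k, x, by grind [SimpleGraph.adj_comm]⟩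
    · exact ⟨o', z, by grind [SimpleGraph.adj_comm]⟩
  have hcard : ({o}ᶜ ×ˢ {a, b} ∪ {o} ×ˢ (A ∪ B)ᶜ : Finset (K × W)).card =
      (Fintype.card K - 1) * 2 + (Fintype.card W - (A ∪ B).card) := by
    rw [card_compl_product_union, card_pair hne, card_compl]
  have h1 := hG.card_le_card_of_private hS hT
  rw [hcard] at h1
  have h2 := card_union_add_card_inter A B
  have h3 : (A ∪ B).card ≤ Fintype.card W := card_le_univ _
  have hAc : A.card = H.degree a + 1 := card_insert_neighborFinset H a
  have hBc : B.card = H.degree b + 1 := card_insert_neighborFinset H b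
  have hda := hG.degree_lt_card a
  have hdb := hG.degree_lt_card b
  have hsub : {a, b} ⊆ A ∩ B := by
    intro y
    simp only [mem_insert, mem_singleton, mem_inter, memA, memB]
    rintro (rfl | rfl)
    exacts [⟨Or.inl rfl, Or.inr hab.symm⟩, ⟨Or.inr hab, Or.inl rfl⟩]
  have h4 := card_le_card hsub
  rw [card_pair hne] at h4
  -- The bounds `2(m - 1) ≤ |A ∪ B|`, `|A|, |B| ≤ m` and `|A ∩ B| ≥ 2` must all be equalities.
  have hinter : {a, b} = A ∩ B := by
    apply eq_of_subset_of_card_le hsub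
    rw [card_pair hne]
    omega
  obtain ⟨y, hay, hy⟩ := hG.exists_adj_forall_adj (v := a) (by omega)
  have hyB : y ∉ B := by
    intro hyB
    have : y ∈ ({a, b} : Finset W) := hinter ▸ mem_inter.2 ⟨(memA y).2 (Or.inr hay), hyB⟩
    rw [mem_insert, mem_singleton] at this
    rcases this with rfl | rfl
    · exact hay.ne rfl
    · grind
  -- Since `N[y] ⊆ A` and `y ∉ B`, `(o, y)` is a private neighbor of `(o, a)`, which gives one
  -- element too many.
  have h5 := hG.card_le_card_of_private (T := insert (o, a) ({o}ᶜ ×ˢ {a, b} ∪ {o} ×ˢ (A ∪ B)ᶜ))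
    hS ?_
  · rw [card_insert_of_notMem, hcard] at h5
    · omega
    · simp [memA]
  · intro t ht
    rcases mem_insert.1 ht with rfl | ht
    · refine ⟨o, y, fun j z hz => ?_⟩
      simp only [mem_union, mem_product, mem_compl, mem_singleton, mem_insert, mem_univ, true_and,
        memA, memB, Prod.mk.injEq] at hz hyB ⊢
      grind [SimpleGraph.adj_comm]
    · exact hT t ht

/-- For `d` of maximum degree, nestedness puts the closed neighborhood of each neighbor inside
`N[d]`, so `N[d]` is closed under adjacency. -/
theorem exists_universal_vertex (hG : IsWellDominated ((⊤ : SimpleGraph K) □ H))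
    (hH : H.Connected) : ∃ d, ∀ x, x ≠ d → H.Adj d x := by
  have := hH.nonempty
  obtain ⟨d, hd⟩ := H.exists_maximal_degree_vertex
  have hsub : ∀ x, H.Adj d x → insert x (H.neighborFinset x) ⊆ insert d (H.neighborFinset d) := by
    intro x hx
    rcases hG.closedNeighborhood_subset_or_subset hx with h | h
    · refine (eq_of_subset_of_card_le h ?_).ge
      rw [card_insert_neighborFinset, card_insert_neighborFinset, ← hd]
      exact Nat.succ_le_succ (H.degree_le_maxDegree x)
    · exact h
  refine ⟨d, fun x hx => ?_⟩
  have key : ∀ x, Relation.ReflTransGen H.Adj d x → x = d ∨ H.Adj d x := by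
    intro x hx
    induction hx with
    | refl => exact Or.inl rfl
    | tail _ hyz ih =>
      rcases ih with rfl | ih
      · exact Or.inr hyz
      · simpa using hsub _ ih (mem_insert_of_mem ((H.mem_neighborFinset _ _).2 hyz))
  exact (key x ((H.reachable_iff_reflTransGen d x).1 (hH.preconnected d x))).resolve_left hx

theorem card_eq_of_universal [Nontrivial W] (hG : IsWellDominated ((⊤ : SimpleGraph K) □ H))
    {d : W} (hd : ∀ x, x ≠ d → H.Adj d x) : Fintype.card K = Fintype.card W := by
  apply le_antisymm
  · have := hG.card_le_card_of_private (S := univ ×ˢ {d}) (T := univ ×ˢ {d}) ?_ ?_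
    · simpa using this
    · rw [isDominatingSet_top_boxProd_iff]
      intro i w
      by_cases hw : w = d
      · exact Or.inl ⟨i, by simp [hw]⟩
      · exact Or.inr ⟨d, hd w hw, by simp⟩
    · rintro ⟨i, w⟩ hi
      obtain ⟨x, hx⟩ := exists_ne d
      refine ⟨i, x, ?_⟩
      grind
  · have h1 := hG.degree_lt_card d
    have h2 : insert d (H.neighborFinset d) = univ := by
      ext x
      simp only [mem_insert, mem_neighborFinset, mem_univ, iff_true]
      grind
    have h3 := card_insert_neighborFinset H d
    rw [h2, card_univ] at h3
    omega

theorem eq_top_of_three_lt_card (hG : IsWellDominated ((⊤ : SimpleGraph K) □ H))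
    (hcard : Fintype.card K = Fintype.card W) (h3 : 3 < Fintype.card W)
    {d : W} (hd : ∀ x, x ≠ d → H.Adj d x) : H = ⊤ := by
  obtain ⟨o, o', ho⟩ := exists_pair_ne K
  have hlt : ∀ s : Finset W, 2 ≤ s.card → ∀ a : W,
      Fintype.card W < ({o}ᶜ ×ˢ {a} ∪ {o} ×ˢ s : Finset (K × W)).card := by
    intro s hs a
    rw [card_compl_product_union, card_singleton]
    omega
  -- Two nonneighbors of `a` would give too many private neighbors: `(k, d)` for `(k, a)` with `k ≠
  -- o`, and `(o', z)` for `(o, z)` with `z` a nonneighbor.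
  have hnonadj : ∀ a b c, b ≠ c → b ≠ a → c ≠ a → ¬ H.Adj a b → H.Adj a c := by
    intro a b c hbc hba hca hab
    by_contra hac
    have had : a ≠ d := by
      rintro rfl
      exact hab (hd b hba)
    refine (hlt (univ.filter fun x => x ≠ a ∧ ¬ H.Adj a x) ?_ a).not_ge
      (hG.card_le_card_of_private (S := {o}ᶜ ×ˢ {a} ∪ {o} ×ˢ {a, d}ᶜ) ?_ ?_)
    · rw [← card_pair hbc]
      exact card_le_card (by grind)
    · rw [isDominatingSet_top_boxProd_iff]
      intro i w
      simp only [mem_union, mem_product, mem_compl, mem_singleton, mem_insert]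
      by_cases hwa : w = a
      · exact Or.inl ⟨o', by grind⟩
      by_cases hwd : w = d
      · subst hwd
        by_cases hi : i = o
        · exact Or.inr ⟨b, (hd b (by grind [SimpleGraph.adj_comm])).symm,
            by grind [SimpleGraph.adj_comm]⟩
        · exact Or.inr ⟨a, (hd a had).symm, by grind⟩
      · exact Or.inl ⟨o, by grind⟩
    · rintro ⟨k, z⟩ ht
      simp only [mem_union, mem_product, mem_compl, mem_singleton, mem_insert, mem_filter,
        mem_univ, true_and, Prod.mk.injEq] at ht ⊢
      rcases ht with ⟨hk, rfl⟩ | ⟨rfl, hz⟩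
      · exact ⟨k, d, by grind⟩
      · exact ⟨o', z, by grind⟩
  by_contra hne
  obtain ⟨a, b, hab, hnab⟩ : ∃ a b, a ≠ b ∧ ¬ H.Adj a b := by
    by_contra! h
    exact hne (by ext a b; exact ⟨fun h => h.ne, fun h' => h a b h'⟩)
  have had : a ≠ d := by
    rintro rfl
    exact hnab (hd b hab.symm)
  have hbd : b ≠ d := by
    rintro rfl
    exact hnab (hd a hab).symm
  -- The fourth vertex makes `(k, x)` a private neighbor of `(k, d)` for `k ≠ o`.
  obtain ⟨x, hx⟩ : ∃ x, x ∉ ({a, b, d} : Finset W) := by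
    by_contra! h
    have := card_le_card (fun x _ => h x : univ ⊆ ({a, b, d} : Finset W))
    rw [card_univ] at this
    have := card_le_three (a := a) (b := b) (c := d)
    omega
  simp only [mem_insert, mem_singleton, not_or] at hx
  refine (hlt {a, b} (card_pair hab).ge d).not_ge
    (hG.card_le_card_of_private (S := {o}ᶜ ×ˢ {d} ∪ {o} ×ˢ {a, b}) ?_ ?_)
  · rw [isDominatingSet_top_boxProd_iff]
    intro i w
    simp only [mem_union, mem_product, mem_compl, mem_singleton, mem_insert]
    by_cases hwd : w = d
    · exact Or.inl ⟨o', by grind⟩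
    by_cases hwa : w = a
    · exact Or.inl ⟨o, by grind⟩
    by_cases hwb : w = b
    · exact Or.inl ⟨o, by grind⟩
    by_cases hi : i = o
    · exact Or.inr ⟨a, hnonadj a b w (Ne.symm hwb) hab.symm hwa hnab, by grind⟩
    · exact Or.inr ⟨d, hd w hwd, by grind⟩
  · rintro ⟨k, z⟩ ht
    simp only [mem_union, mem_product, mem_compl, mem_singleton, mem_insert,
      Prod.mk.injEq] at ht ⊢
    rcases ht with ⟨hk, rfl⟩ | ⟨rfl, hz⟩
    · exact ⟨k, x, by grind⟩
    · exact ⟨k, z, by grind [SimpleGraph.adj_comm]⟩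

end

end IsWellDominated

/-! ### Identifying the second factor -/

theorem nonempty_iso_top_of_card_eq {W : Type*} [Fintype W] {n : ℕ} (hn : Fintype.card W = n) :
    Nonempty ((⊤ : SimpleGraph W) ≃g (⊤ : SimpleGraph (Fin n))) :=
  ⟨Iso.completeGraph (Fintype.equivFinOfCardEq hn)⟩

/-- A noncomplete graph of order three with a universal vertex is a path. -/
theorem nonempty_iso_pathGraph_three {W : Type*} [Fintype W] {H : SimpleGraph W}
    (hW : Fintype.card W = 3) {d : W} (hd : ∀ x, x ≠ d → H.Adj d x) (hH : H ≠ ⊤) :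
    Nonempty (H ≃g pathGraph 3) := by
  classical
  obtain ⟨e, he⟩ : ∃ e : W ≃ Fin 3, e d = 1 := by
    let e := Fintype.equivFinOfCardEq hW
    exact ⟨e.trans (Equiv.swap (e d) 1), by simp⟩
  obtain ⟨a, b, hab, hnab⟩ : ∃ a b, a ≠ b ∧ ¬ H.Adj a b := by
    by_contra! h
    exact hH (by ext a b; exact ⟨fun h => h.ne, fun h' => h a b h'⟩)
  refine ⟨⟨e, ?_⟩⟩
  intro x y
  have had : a ≠ d := by
    rintro rfl
    exact hnab (hd b hab.symm)
  have hbd : b ≠ d := by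
    rintro rfl
    exact hnab (hd a hab).symm
  have hmem : ∀ z, z = a ∨ z = b ∨ z = d := by
    have : ({a, b, d} : Finset W) = univ := by
      apply eq_univ_of_card
      rw [hW, card_eq_three]
      exact ⟨a, b, d, hab, had, hbd, rfl⟩
    intro z
    have hz := mem_univ z
    rw [← this] at hz
    simpa using hz
  have he1 : ∀ z, e z = 1 ↔ z = d := fun z => by rw [← he, e.injective.eq_iff]
  have hadj : ∀ j j' : Fin 3, (pathGraph 3).Adj j j' ↔ j ≠ j' ∧ (j = 1 ∨ j' = 1) := by
    intro j j'
    rw [pathGraph_adj]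
    grind
  rw [hadj, e.injective.ne_iff, he1, he1]
  have := hmem x
  have := hmem y
  have := H.ne_of_adj (a := x) (b := y)
  grind [SimpleGraph.adj_comm]

end

theorem theorem1p3 (m : ℕ) (hm : 2 ≤ m) {W : Type*} [Finite W] [Nontrivial W]
    (H : SimpleGraph W) (hH : H.Connected) :
    IsWellDominated ((⊤ : SimpleGraph (Fin m)) □ H) ↔
      (m ≠ 3 ∧ Nonempty (H ≃g (⊤ : SimpleGraph (Fin m)))) ∨
      (m = 3 ∧ (Nonempty (H ≃g (⊤ : SimpleGraph (Fin 3))) ∨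
        Nonempty (H ≃g SimpleGraph.pathGraph 3))) := by
  classical
  have := Fintype.ofFinite W
  have : Nontrivial (Fin m) := Fin.nontrivial_iff_two_le.2 hm
  constructor
  · intro hG
    obtain ⟨d, hd⟩ := hG.exists_universal_vertex hH
    have hcard := hG.card_eq_of_universal hd
    by_cases htop : H = ⊤
    · subst htop
      have hiso := nonempty_iso_top_of_card_eq (W := W) (hcard.symm.trans (Fintype.card_fin m))
      by_cases h3 : m = 3
      · subst h3
        exact Or.inr ⟨rfl, Or.inl hiso⟩
      · exact Or.inl ⟨h3, hiso⟩
    · have hle : Fintype.card W ≤ 3 := by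
        by_contra! h3
        exact htop (hG.eq_top_of_three_lt_card hcard h3 hd)
      have hW : Fintype.card W = 3 := by
        by_contra hne
        have hlt : Fintype.card W ≤ 2 := by omega
        refine htop (SimpleGraph.ext (funext₂ fun a b => propext ⟨fun h => h.ne, fun hab => ?_⟩))
        have hab : a ≠ b := hab
        by_cases had : a = d
        · exact had ▸ hd b (had ▸ hab.symm)
        by_cases hbd : b = d
        · exact hbd ▸ (hd a (hbd ▸ hab)).symm
        have := Finset.card_le_univ ({a, b, d} : Finset W)
        rw [Finset.card_eq_three.2 ⟨a, b, d, hab, had, hbd, rfl⟩] at this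
        omega
      rw [Fintype.card_fin, hW] at hcard
      exact Or.inr ⟨hcard, Or.inr (nonempty_iso_pathGraph_three hW hd htop)⟩
  · rintro (⟨-, ⟨e⟩⟩ | ⟨rfl, ⟨⟨e⟩⟩ | ⟨⟨e⟩⟩⟩)
    · exact (isWellDominated_top_boxProd_top (Fin m)).of_iso (.boxProdRight _ e.symm)
    · exact (isWellDominated_top_boxProd_top (Fin 3)).of_iso (.boxProdRight _ e.symm)
    · exact isWellDominated_top_boxProd_pathGraph_three.of_iso (.boxProdRight _ e.symm)
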